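/- In the convex body chasing problem in $\mathbb{R}^d$ (Euclidean norm), one starts at $x_0=0$; at each time $t=1,2,\dots$ a nonempty closed convex set $K_t\subseteq\mathbb{R}^d$ is revealed, and the algorithm has to choose a point $x_t\in K_t$ depending only on $K_1,\dots,K_t$. Its cost on a request sequence of length $T$ is $\sum_{t=1}^T\|x_t-x_{t-1}\|$, and $\mathrm{OPT}_T$ denotes the infimum of $\sum_{t=1}^T\|y_t-y_{t-1}\|$ over all $y_0=0$, $y_1\in K_1,\dots,y_T\in K_T$. No nesting of the sets $K_t$ is assumed. Let $$w_t(x)=\inf\Big\{\sum_{s=1}^t\|y_s-y_{s-1}\|+\|y_t-x\| : y_0=0,\ y_s\in K_s \text{ for } 1\le s\le t\Big\}$$ be the work function, and for a nonempty compact convex set $S$ let $$\mathrm{st}(S)=d\int_{S^{d-1}}\theta\, h_S(\theta)\,d\omega(\theta),\qquad h_S(\theta)=\max_{x\in S}\langle\theta,x\rangle,$$ be its Steiner point, where $\omega$ is the uniform probability measure on the unit sphere $S^{d-1}$. Consider the following online algorithm. It stays at $0$, with guess $r=0$, until the first request $K_{t_0}$ with $0\notin K_{t_0}$, when it sets $r=\mathrm{dist}(0,K_{t_0})$.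 At each time $t\ge t_0$ it replaces $r$ by $2r$ as long as $\Omega_t=\{x : w_t(x)\le 2r\}$ is empty, and then moves to $x_t=\mathrm{st}(\Omega_t)$. **Theorem.** There is an absolute constant $C>0$ such that for every dimension $d$, every $T\ge 2$ and every sequence $K_1,\dots,K_T$ of nonempty closed convex subsets of $\mathbb{R}^d$, the algorithm satisfies $x_t\in K_t$ for all $1\le t\le T$, and $$\sum_{t=1}^T\|x_t-x_{t-1}\|\ \le\ C\,\min\big(d,\sqrt{d\log T}\big)\cdot \mathrm{OPT}_T .$$ In other words, there is an $O(\min(d,\sqrt{d\log T}))$-competitive online algorithm for general convex body chasing in $d$-dimensional Euclidean space; the algorithm does not need to know $T$. -/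

import Mathlib

namespace BodyChasing

noncomputable section

/-- Euclidean `d`-space with the Euclidean norm. -/
abbrev Space (d : ℕ) : Type := EuclideanSpace ℝ (Fin d)

/-- A request is a nonempty closed convex set. -/
structure IsRequest {d : ℕ} (S : Set (Space d)) : Prop where
  closed : IsClosed S
  convex : Convex ℝ S
  nonempty : S.Nonempty

/-- The movement cost `∑_{t=1}^T ‖x_t - x_{t-1}‖` of the first `T` steps of a trajectory. -/
def pathCost {d : ℕ} (x : ℕ → Space d) (T : ℕ) : ℝ :=
  ∑ t ∈ Finset.range T, ‖x (t + 1) - x t‖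

/-- The trajectory `x` starts at `x_0 = 0` and serves the requests `K_1, …, K_T`.
(The set `K 0` and the points after time `T` play no role.) -/
def IsFeasible {d : ℕ} (K : ℕ → Set (Space d)) (T : ℕ) (x : ℕ → Space d) : Prop :=
  x 0 = 0 ∧ ∀ t, 1 ≤ t → t ≤ T → x t ∈ K t

/-- The optimal offline cost `OPT` of the requests `K_1, …, K_T`. -/
def opt {d : ℕ} (K : ℕ → Set (Space d)) (T : ℕ) : ℝ :=
  sInf {c : ℝ | ∃ x : ℕ → Space d, IsFeasible K T x ∧ c = pathCost x T}

/-- The work function `w_t(y)`: the optimal cost of a trajectory that starts at `0`, serves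
`K_1, …, K_t`, and then moves to `y`. -/
def work {d : ℕ} (K : ℕ → Set (Space d)) (t : ℕ) (y : Space d) : ℝ :=
  sInf {c : ℝ | ∃ x : ℕ → Space d, IsFeasible K t x ∧ c = pathCost x t + ‖x t - y‖}

/-- The sublevel set `{y | w_t(y) ≤ a}` of the work function. -/
def sublevel {d : ℕ} (K : ℕ → Set (Space d)) (t : ℕ) (a : ℝ) : Set (Space d) :=
  {y | work K t y ≤ a}

/-- The support function `h_S(θ) = max_{x ∈ S} ⟨θ, x⟩`. -/
def supportFn {d : ℕ} (S : Set (Space d)) (θ : Space d) : ℝ :=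
  sSup ((fun x : Space d => inner ℝ θ x) '' S)

/-- The Steiner point `st(S) = d ∫ θ h_S(θ) dω(θ)` of a bounded convex body, where `ω` is the
uniform probability measure on the unit sphere (the surface measure, normalized by the average
integral). -/
def steinerPoint {d : ℕ} (S : Set (Space d)) : Space d :=
  (d : ℝ) • ⨍ θ : Metric.sphere (0 : Space d) 1, supportFn S (θ : Space d) • (θ : Space d)
    ∂(MeasureTheory.volume : MeasureTheory.Measure (Space d)).toSphere

/-- Doubling of the guess: `r, 2r, 4r, …` until `{y | w_t(y) ≤ 2r}` is nonempty. -/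
def doubling {d : ℕ} (K : ℕ → Set (Space d)) (t : ℕ) (r : ℝ) : ℝ :=
  2 ^ sInf {n : ℕ | (sublevel K t (2 * (2 ^ n * r))).Nonempty} * r

open scoped Classical in
/-- The guess `r` for `OPT` after the loop at time `t`. It is initialized with `dist(0, K_t)` at
the first request that does not contain the origin, and it is `0` before that time. -/
def guess {d : ℕ} (K : ℕ → Set (Space d)) : ℕ → ℝ
  | 0 => 0
  | t + 1 =>
    doubling K (t + 1) (if guess K t = 0 then Metric.infDist 0 (K (t + 1)) else guess K t)

/-- The trajectory of the algorithm: `x_0 = 0`, and `x_t` is the Steiner point of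
`Ω_t = {y | w_t(y) ≤ 2r}` for the guess `r` at time `t`. -/
def steinerTrajectory {d : ℕ} (K : ℕ → Set (Space d)) : ℕ → Space d
  | 0 => 0
  | t + 1 => steinerPoint (sublevel K (t + 1) (2 * guess K (t + 1)))

/-- A (deterministic) online algorithm: it starts at the origin, and its position at time `t`
is a function of the requests `K_1, …, K_t` only. -/
structure OnlineAlgorithm (d : ℕ) where
  /-- The position at a time on a request sequence. -/
  point : (ℕ → Set (Space d)) → ℕ → Space d
  start : ∀ K, point K 0 = 0
  online : ∀ K K' t, (∀ s, 1 ≤ s → s ≤ t → K s = K' s) → point K t = point K' t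

/-- On all request sequences of length `T`, the algorithm serves every request, at cost at most
`ρ` times the optimal offline cost. -/
def OnlineAlgorithm.IsCompetitive {d : ℕ} (A : OnlineAlgorithm d) (T : ℕ) (ρ : ℝ) : Prop :=
  ∀ K : ℕ → Set (Space d), (∀ t, 1 ≤ t → t ≤ T → IsRequest (K t)) →
    (∀ t, 1 ≤ t → t ≤ T → A.point K t ∈ K t) ∧ pathCost (A.point K) T ≤ ρ * opt K T

theorem sublevel_congr {d : ℕ} {K K' : ℕ → Set (Space d)} {t : ℕ}
    (h : ∀ s, 1 ≤ s → s ≤ t → K s = K' s) : sublevel K t = sublevel K' t := by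
  have hf : ∀ x, IsFeasible K t x ↔ IsFeasible K' t x := fun x =>
    and_congr_right fun _ => forall_congr' fun s => forall_congr' fun h1 =>
      forall_congr' fun h2 => by rw [h s h1 h2]
  funext a
  simp only [sublevel, work, hf]

theorem guess_congr {d : ℕ} {K K' : ℕ → Set (Space d)} {t : ℕ}
    (h : ∀ s, 1 ≤ s → s ≤ t → K s = K' s) : guess K t = guess K' t := by
  induction t with
  | zero => rfl
  | succ t ih =>
    simp only [guess, doubling, ih fun s h1 h2 => h s h1 (by omega), sublevel_congr h,
      h (t + 1) (by omega) le_rfl]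

/-- Chasing convex bodies by the Steiner point of a sublevel set of the work function. -/
def steinerAlgorithm (d : ℕ) : OnlineAlgorithm d where
  point := steinerTrajectory
  start _ := rfl
  online K K' t h := by
    cases t with
    | zero => rfl
    | succ t => simp only [steinerTrajectory, guess_congr h, sublevel_congr h]

end

end BodyChasing

/-! Cost: while the guess `r` is fixed, the bodies `Ω_t` are nested, because the work function only
grows, and they lie in the ball of radius `2r`. For nested `S' ⊆ S` and a unit vector `u`, the
`u`-component of `st(S) - st(S')` is `d ∫ ⟪u, θ⟫ (h_S - h_S')`, with a nonnegative second factor.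
Since `⟪u, θ⟫ ≤ 1`, the movement is at most `d` times the drop of the mean support, which telescopes
(`norm_steinerPoint_sub_le_linear`). Since moreover `⟪u, θ⟫ ≤ ε` outside a small cap, `d` can be
replaced by `d ε` up to an error coming from the cap (`norm_steinerPoint_sub_le_of_cap`). With `ε =
√(4 log T / d)` the cap has measure at most `T⁻²`, and the errors of `T` steps add up to `O(√d r)`.

A change of guess costs `O(√d r)` for the new `r`, as Steiner points of bodies in a ball of radius
`R` have norm at most `√d R`. The guesses at least double and never exceed `OPT`, so these costs
form a geometric sum (`sum_le_of_doubling`).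

Feasibility: if a half-space contains `K_t`, reflecting an outside point into it does not increase
`w_t`, since the path ends its service inside the half-space (`reflection_mem_sublevel`). By
symmetrizing the Steiner integral under this reflection, `st(Ω_t)` lies in the half-space
(`inner_le_inner_steinerPoint`), hence in `K_t`. -/

namespace BodyChasing

noncomputable section

open MeasureTheory Metric Set
open scoped Pointwise RealInnerProductSpace

variable {d : ℕ}

/-! ### Uniform measure on the sphere: invariance, second moments, caps. -/

/-- The unit sphere of Euclidean `d`-space. -/
abbrev UnitSphere (d : ℕ) : Type := Metric.sphere (0 : Space d) 1

/-- The normalized surface measure on the unit sphere. -/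
def sphereProb (d : ℕ) : Measure (UnitSphere d) :=
  ((volume : Measure (Space d)).toSphere univ)⁻¹ • (volume : Measure (Space d)).toSphere

instance [NeZero d] : IsProbabilityMeasure (sphereProb d) := by
  have : Nontrivial (Space d) :=
    Module.nontrivial_of_finrank_pos (R := ℝ) (by simpa using NeZero.pos d)
  have : NeZero (volume : Measure (Space d)).toSphere := ⟨Measure.toSphere_ne_zero _⟩
  exact isProbabilityMeasureSMul

/-- The map induced on the unit sphere by a linear isometry. -/
def sphereMap (R : Space d ≃ₗᵢ[ℝ] Space d) (θ : UnitSphere d) : UnitSphere d :=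
  ⟨R θ, by simp⟩

@[simp]
theorem coe_sphereMap (R : Space d ≃ₗᵢ[ℝ] Space d) (θ : UnitSphere d) :
    (sphereMap R θ : Space d) = R θ := rfl

theorem continuous_sphereMap (R : Space d ≃ₗᵢ[ℝ] Space d) : Continuous (sphereMap R) :=
  (R.continuous.comp continuous_subtype_val).subtype_mk _

/-- The surface measure of `s` is `d` times the volume of the cone `(0, 1) • s`; a linear isometry
carries cones to cones and preserves volume. -/
theorem measurePreserving_sphereMap (R : Space d ≃ₗᵢ[ℝ] Space d) :
    MeasurePreserving (sphereMap R) (sphereProb d) (sphereProb d) := by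
  refine MeasurePreserving.smul_measure ⟨(continuous_sphereMap R).measurable, ?_⟩ _
  ext s hs
  rw [Measure.map_apply (continuous_sphereMap R).measurable hs, Measure.toSphere_apply' _ hs,
    Measure.toSphere_apply' _ ((continuous_sphereMap R).measurable hs)]
  congr 1
  rw [← R.symm.measurePreserving.measure_preimage_emb R.symm.toHomeomorph.measurableEmbedding]
  congr 1
  ext x
  simp only [mem_smul, mem_image, mem_preimage]
  constructor
  · rintro ⟨t, ht, _, ⟨θ, hθ, rfl⟩, hx⟩
    exact ⟨t, ht, _, ⟨sphereMap R θ, hθ, rfl⟩, R.symm.injective (by simpa using hx)⟩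
  · rintro ⟨t, ht, _, ⟨θ, hθ, rfl⟩, rfl⟩
    refine ⟨t, ht, _, ⟨sphereMap R.symm θ, ?_, rfl⟩, by simp⟩
    convert hθ
    ext1
    simp

theorem integral_comp_sphereMap (R : Space d ≃ₗᵢ[ℝ] Space d) {f : UnitSphere d → ℝ}
    (hf : Continuous f) :
    ∫ θ, f (sphereMap R θ) ∂sphereProb d = ∫ θ, f θ ∂sphereProb d := by
  conv_rhs => rw [← (measurePreserving_sphereMap R).map_eq]
  exact (integral_map (continuous_sphereMap R).measurable.aemeasurable
    hf.aestronglyMeasurable).symm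

theorem integrable_sphereProb [NeZero d] {E : Type*} [NormedAddCommGroup E]
    {f : UnitSphere d → E} (hf : Continuous f) : Integrable f (sphereProb d) :=
  hf.integrable_of_hasCompactSupport (HasCompactSupport.of_compactSpace f)

theorem continuous_inner_sphere (u : Space d) :
    Continuous fun θ : UnitSphere d => ⟪u, (θ : Space d)⟫ := by fun_prop

theorem continuous_inner_sphere_sq (u : Space d) :
    Continuous fun θ : UnitSphere d => ⟪u, (θ : Space d)⟫ ^ 2 := by fun_prop

/-- The reflection in the hyperplane orthogonal to `u - v` maps `u` to `v` and preserves the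
measure. -/
theorem integral_inner_sq_eq_of_norm_eq {u v : Space d} (h : ‖u‖ = ‖v‖) :
    ∫ θ : UnitSphere d, ⟪u, (θ : Space d)⟫ ^ 2 ∂sphereProb d
      = ∫ θ : UnitSphere d, ⟪v, (θ : Space d)⟫ ^ 2 ∂sphereProb d := by
  rw [← integral_comp_sphereMap ((ℝ ∙ (u - v))ᗮ.reflection)
    (continuous_inner_sphere_sq v)]
  refine integral_congr_ae (.of_forall fun θ => ?_)
  simp only [coe_sphereMap]
  rw [← LinearIsometryEquiv.inner_map_map ((ℝ ∙ (u - v))ᗮ.reflection) u,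
    Submodule.reflection_sub h]

theorem norm_coe_sphere (θ : UnitSphere d) : ‖(θ : Space d)‖ = 1 := by simp

/-- By invariance, the `d` vectors `‖u‖ • b i` all give the same integral as `u`, and by Parseval on
the sphere their integrals sum to `‖u‖ ^ 2`. -/
theorem integral_inner_sq [NeZero d] (u : Space d) :
    ∫ θ : UnitSphere d, ⟪u, (θ : Space d)⟫ ^ 2 ∂sphereProb d = ‖u‖ ^ 2 / d := by
  have hd : (d : ℝ) ≠ 0 := NeZero.ne _
  let b := EuclideanSpace.basisFun (Fin d) ℝ
  have h1 : ∀ i, ∫ θ : UnitSphere d, ⟪‖u‖ • b i, (θ : Space d)⟫ ^ 2 ∂sphereProb d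
      = ∫ θ : UnitSphere d, ⟪u, (θ : Space d)⟫ ^ 2 ∂sphereProb d := fun i =>
    integral_inner_sq_eq_of_norm_eq (by simp [norm_smul])
  have h2 : ∑ i, ∫ θ : UnitSphere d, ⟪‖u‖ • b i, (θ : Space d)⟫ ^ 2 ∂sphereProb d
      = ‖u‖ ^ 2 := by
    rw [← integral_finsetSum _ fun i _ =>
      integrable_sphereProb (continuous_inner_sphere_sq (‖u‖ • b i))]
    have : ∀ θ : UnitSphere d, ∑ i, ⟪‖u‖ • b i, (θ : Space d)⟫ ^ 2 = ‖u‖ ^ 2 := fun θ => by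
      simp only [real_inner_smul_left, mul_pow, ← Finset.mul_sum]
      have := b.sum_sq_norm_inner_right (θ : Space d)
      simp only [Real.norm_eq_abs, sq_abs, norm_coe_sphere] at this
      rw [this]; ring
    simp [this]
  simp only [h1, Finset.sum_const, Finset.card_univ, Fintype.card_fin, nsmul_eq_mul] at h2
  rw [← h2]; field_simp

theorem integral_inner_mul_inner [NeZero d] (u v : Space d) :
    ∫ θ : UnitSphere d, ⟪u, (θ : Space d)⟫ * ⟪(θ : Space d), v⟫ ∂sphereProb d = ⟪u, v⟫ / d := by
  have h : ∀ θ : UnitSphere d, ⟪u, (θ : Space d)⟫ * ⟪(θ : Space d), v⟫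
      = (⟪u + v, (θ : Space d)⟫ ^ 2 - ⟪u - v, (θ : Space d)⟫ ^ 2) / 4 := fun θ => by
    rw [inner_add_left, inner_sub_left, real_inner_comm v]; ring
  simp only [h]
  rw [integral_div, integral_sub (integrable_sphereProb (continuous_inner_sphere_sq _))
    (integrable_sphereProb (continuous_inner_sphere_sq _)), integral_inner_sq,
    integral_inner_sq, norm_add_sq_real, norm_sub_sq_real]
  ring

/-- On the cone, `‖tθ - εu‖² ≤ t² - 2tε² + ε²`. This is convex in `t`, equals `1 - ε²` at `t = 1`,
and is at most that at `t = 0` exactly when `ε² ≤ 1/2`. -/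
theorem smul_cap_subset_closedBall {u : Space d} (hu : ‖u‖ = 1) {ε : ℝ} (hε0 : 0 ≤ ε)
    (hε : ε ^ 2 ≤ 1 / 2) :
    Ioo (0 : ℝ) 1 • ((↑) '' {θ : UnitSphere d | ε ≤ ⟪u, (θ : Space d)⟫} : Set (Space d))
      ⊆ closedBall (ε • u) √(1 - ε ^ 2) := by
  rintro _ ⟨t, ht, _, ⟨θ, hθ, rfl⟩, rfl⟩
  change ε ≤ ⟪u, (θ : Space d)⟫ at hθ
  rw [mem_closedBall, dist_eq_norm]
  apply Real.le_sqrt_of_sq_le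
  simp only
  rw [norm_sub_sq_real, norm_smul, norm_smul, norm_coe_sphere, hu, real_inner_smul_left,
    real_inner_smul_right, real_inner_comm]
  simp only [Real.norm_eq_abs, mul_one, sq_abs]
  have h1 : t * (ε * ε) ≤ t * (ε * ⟪u, (θ : Space d)⟫) := by
    have := ht.1.le
    gcongr
  nlinarith [mul_nonneg ht.1.le (sub_nonneg.2 ht.2.le), mul_nonneg (sub_nonneg.2 ht.2.le)
    (sub_nonneg.2 hε)]

/-- Concentration of measure: the measure of a spherical cap. -/
theorem sphereProb_cap_le [NeZero d] {u : Space d} (hu : ‖u‖ = 1) {ε : ℝ} (hε0 : 0 ≤ ε)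
    (hε : ε ^ 2 ≤ 1 / 2) :
    (sphereProb d).real {θ : UnitSphere d | ε ≤ ⟪u, (θ : Space d)⟫} ≤ √(1 - ε ^ 2) ^ d := by
  have hm : MeasurableSet {θ : UnitSphere d | ε ≤ ⟪u, (θ : Space d)⟫} :=
    (isClosed_le continuous_const (continuous_inner_sphere u)).measurableSet
  have hd : (d : ℝ) ≠ 0 := NeZero.ne _
  have hb : 0 < (volume : Measure (Space d)).real (ball 0 1) :=
    ENNReal.toReal_pos (measure_ball_pos _ _ one_pos).ne' measure_ball_lt_top.ne
  have h1 := measureReal_mono (μ := (volume : Measure (Space d)))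
    (smul_cap_subset_closedBall hu hε0 hε) measure_closedBall_lt_top.ne
  have h2 : (volume : Measure (Space d)).real (closedBall (ε • u) √(1 - ε ^ 2))
      = √(1 - ε ^ 2) ^ d * (volume : Measure (Space d)).real (ball 0 1) := by
    rw [measureReal_def, Measure.addHaar_closedBall _ _ (Real.sqrt_nonneg _), ENNReal.toReal_mul,
      ENNReal.toReal_ofReal (by positivity), finrank_euclideanSpace_fin, measureReal_def]
  -- The normalized measure of a cap is the volume fraction of the unit ball filled by the cone over
  -- it; the factors `d` cancel.
  have h3 : (sphereProb d).real {θ : UnitSphere d | ε ≤ ⟪u, (θ : Space d)⟫}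
      = (volume : Measure (Space d)).real (Ioo (0 : ℝ) 1 •
          ((↑) '' {θ : UnitSphere d | ε ≤ ⟪u, (θ : Space d)⟫} : Set (Space d)))
        / (volume : Measure (Space d)).real (ball 0 1) := by
    rw [sphereProb, measureReal_def, Measure.smul_apply, Measure.toSphere_apply' _ hm,
      Measure.toSphere_apply_univ, smul_eq_mul, ENNReal.toReal_mul, ENNReal.toReal_inv,
      ENNReal.toReal_mul, ENNReal.toReal_mul, finrank_euclideanSpace_fin, ENNReal.toReal_natCast,
      ← measureReal_def, ← measureReal_def]
    field_simp
  rw [h3, div_le_iff₀ hb, ← h2]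
  exact h1

/-! ### Norms by duality, and hyperplane reflections. -/

theorem norm_le_of_forall_inner_le {v : Space d} {M : ℝ} (hM : 0 ≤ M)
    (h : ∀ u : Space d, ‖u‖ = 1 → ⟪u, v⟫ ≤ M) : ‖v‖ ≤ M := by
  rcases eq_or_ne v 0 with rfl | hv
  · simpa
  have hv' : ‖v‖ ≠ 0 := norm_ne_zero_iff.2 hv
  have := h (‖v‖⁻¹ • v) (by rw [norm_smul, norm_inv, norm_norm, inv_mul_cancel₀ hv'])
  rwa [real_inner_smul_left, real_inner_self_eq_norm_mul_norm, inv_mul_cancel_left₀ hv'] at this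

theorem reflection_orthogonal_singleton_apply (n v : Space d) :
    (ℝ ∙ n)ᗮ.reflection v = v - (2 * (⟪n, v⟫ / ‖n‖ ^ 2)) • n := by
  rw [Submodule.reflection_orthogonal_apply, Submodule.reflection_singleton_apply, two_smul,
    two_mul, add_smul]
  simp

theorem inner_reflection_orthogonal_left (n v w : Space d) :
    ⟪(ℝ ∙ n)ᗮ.reflection v, w⟫ = ⟪v, (ℝ ∙ n)ᗮ.reflection w⟫ := by
  rw [← LinearIsometryEquiv.inner_map_map (ℝ ∙ n)ᗮ.reflection v, Submodule.reflection_reflection]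

/-! ### Support functions, mean support and Steiner points. -/

section Support

variable {S S' : Set (Space d)} {R : ℝ}

theorem inner_le_of_subset_closedBall (hS : S ⊆ closedBall 0 R) {x : Space d} (hx : x ∈ S)
    (θ : Space d) : ⟪θ, x⟫ ≤ R * ‖θ‖ := by
  have := mem_closedBall_zero_iff.1 (hS hx)
  calc ⟪θ, x⟫ ≤ ‖θ‖ * ‖x‖ := real_inner_le_norm _ _
    _ ≤ ‖θ‖ * R := by gcongr
    _ = R * ‖θ‖ := mul_comm _ _

theorem bddAbove_inner_image (hS : S ⊆ closedBall 0 R) (θ : Space d) :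
    BddAbove ((fun x : Space d => ⟪θ, x⟫) '' S) :=
  ⟨R * ‖θ‖, by rintro _ ⟨x, hx, rfl⟩; exact inner_le_of_subset_closedBall hS hx θ⟩

theorem inner_le_supportFn (hS : S ⊆ closedBall 0 R) {x : Space d} (hx : x ∈ S) (θ : Space d) :
    ⟪θ, x⟫ ≤ supportFn S θ :=
  le_csSup (bddAbove_inner_image hS θ) ⟨x, hx, rfl⟩

theorem supportFn_le (hne : S.Nonempty) {θ : Space d} {a : ℝ} (h : ∀ x ∈ S, ⟪θ, x⟫ ≤ a) :
    supportFn S θ ≤ a :=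
  csSup_le (hne.image _) (by rintro _ ⟨x, hx, rfl⟩; exact h x hx)

theorem supportFn_mono (hS : S ⊆ closedBall 0 R) (hne : S'.Nonempty) (h : S' ⊆ S) (θ : Space d) :
    supportFn S' θ ≤ supportFn S θ :=
  supportFn_le hne fun _ hx => inner_le_supportFn hS (h hx) θ

theorem abs_supportFn_le (hS : S ⊆ closedBall 0 R) (hne : S.Nonempty) (θ : Space d) :
    |supportFn S θ| ≤ R * ‖θ‖ := by
  refine abs_le.2 ⟨?_, supportFn_le hne fun x hx => inner_le_of_subset_closedBall hS hx θ⟩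
  obtain ⟨x, hx⟩ := hne
  have h1 := inner_le_of_subset_closedBall hS hx (-θ)
  rw [inner_neg_left, norm_neg] at h1
  linarith [inner_le_supportFn hS hx θ]

theorem radius_nonneg (hS : S ⊆ closedBall 0 R) (hne : S.Nonempty) : 0 ≤ R :=
  nonempty_closedBall.1 (hne.mono hS)

theorem continuous_supportFn (hS : S ⊆ closedBall 0 R) (hne : S.Nonempty) :
    Continuous (supportFn S) := by
  refine (LipschitzWith.of_le_add_mul R.toNNReal fun θ θ' => ?_).continuous
  rw [Real.coe_toNNReal _ (radius_nonneg hS hne), dist_eq_norm]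
  refine supportFn_le hne fun x hx => ?_
  have := inner_le_of_subset_closedBall hS hx (θ - θ')
  rw [inner_sub_left] at this
  linarith [inner_le_supportFn hS hx θ']

theorem continuous_supportFn_sphere (hS : S ⊆ closedBall 0 R) (hne : S.Nonempty) :
    Continuous fun θ : UnitSphere d => supportFn S (θ : Space d) :=
  (continuous_supportFn hS hne).comp continuous_subtype_val

theorem abs_supportFn_sphere_le (hS : S ⊆ closedBall 0 R) (hne : S.Nonempty) (θ : UnitSphere d) :
    |supportFn S (θ : Space d)| ≤ R := by
  simpa using abs_supportFn_le hS hne (θ : Space d)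

/-- The average of the support function over the unit sphere (half of the mean width). -/
def meanSupport (S : Set (Space d)) : ℝ := ∫ θ : UnitSphere d, supportFn S θ ∂sphereProb d

variable [NeZero d]

theorem abs_meanSupport_le (hS : S ⊆ closedBall 0 R) (hne : S.Nonempty) :
    |meanSupport S| ≤ R := by
  have h := norm_integral_le_of_norm_le_const (μ := sphereProb d)
    (f := fun θ : UnitSphere d => supportFn S θ)
    (.of_forall fun θ => abs_supportFn_sphere_le hS hne θ)
  simpa [meanSupport] using h

theorem inner_steinerPoint (hS : S ⊆ closedBall 0 R) (hne : S.Nonempty) (u : Space d) :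
    ⟪u, steinerPoint S⟫
      = d * ∫ θ : UnitSphere d, ⟪u, (θ : Space d)⟫ * supportFn S θ ∂sphereProb d := by
  have h : Integrable (fun θ : UnitSphere d => supportFn S (θ : Space d) • (θ : Space d))
      (sphereProb d) :=
    integrable_sphereProb ((continuous_supportFn_sphere hS hne).smul continuous_subtype_val)
  rw [steinerPoint, average, real_inner_smul_right]
  change _ * ⟪u, ∫ θ : UnitSphere d, supportFn S (θ : Space d) • (θ : Space d) ∂sphereProb d⟫ = _
  rw [← integral_inner h]
  simp only [real_inner_smul_right, mul_comm]

/-- The factor is `√d` instead of `d` because `⟪u, θ⟫` has mean square `1/d`. Cauchy–Schwarz is used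
in its AM–GM form, with weights balanced at `|⟪u, θ⟫| = 1/√d`. -/
theorem norm_steinerPoint_le (hS : S ⊆ closedBall 0 R) (hne : S.Nonempty) :
    ‖steinerPoint S‖ ≤ √d * R := by
  have hR := radius_nonneg hS hne
  have hd : 0 < (d : ℝ) := by exact_mod_cast NeZero.pos d
  have hs : 0 < √(d : ℝ) := Real.sqrt_pos.2 hd
  refine norm_le_of_forall_inner_le (by positivity) fun u hu => ?_
  rw [inner_steinerPoint hS hne]
  have h1 : ∫ θ : UnitSphere d, ⟪u, (θ : Space d)⟫ * supportFn S θ ∂sphereProb d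
      ≤ ∫ θ : UnitSphere d, (√d * R / 2 * ⟪u, (θ : Space d)⟫ ^ 2 + R / (2 * √d))
          ∂sphereProb d := by
    refine integral_mono (integrable_sphereProb ((continuous_inner_sphere u).mul
      (continuous_supportFn_sphere hS hne)))
      (integrable_sphereProb (by fun_prop)) fun θ => ?_
    have h2 : ⟪u, (θ : Space d)⟫ * supportFn S θ ≤ |⟪u, (θ : Space d)⟫| * R := by
      refine (le_abs_self _).trans ?_
      rw [abs_mul]
      gcongr
      exact abs_supportFn_sphere_le hS hne θ
    refine h2.trans ?_
    have h3 : √(d : ℝ) * R / 2 * ⟪u, (θ : Space d)⟫ ^ 2 + R / (2 * √d)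
        - |⟪u, (θ : Space d)⟫| * R = R / (2 * √d) * (√d * |⟪u, (θ : Space d)⟫| - 1) ^ 2 := by
      rw [← sq_abs ⟪u, (θ : Space d)⟫]
      field_simp
      ring
    have h4 : 0 ≤ R / (2 * √(d : ℝ)) * (√d * |⟪u, (θ : Space d)⟫| - 1) ^ 2 := by positivity
    linarith
  rw [integral_add (integrable_sphereProb (by fun_prop)) (integrable_const _),
    integral_const_mul, integral_inner_sq, hu] at h1
  simp only [integral_const, probReal_univ, one_smul] at h1
  calc (d : ℝ) * ∫ θ : UnitSphere d, ⟪u, (θ : Space d)⟫ * supportFn S θ ∂sphereProb d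
      ≤ d * (√d * R / 2 * (1 ^ 2 / d) + R / (2 * √d)) := by gcongr
    _ = √d * R / 2 + d * R / (2 * √d) := by field_simp
    _ = √d * R / 2 + (√d * √d) * R / (2 * √d) := by rw [Real.mul_self_sqrt hd.le]
    _ = √d * R := by field_simp; ring

/-- Two nested sets have Steiner points whose distance is governed by any pointwise upper bound
for the projections of the sphere. -/
theorem norm_steinerPoint_sub_le (hS : S ⊆ closedBall 0 R) (hne : S'.Nonempty) (hSS : S' ⊆ S)
    {a b : ℝ} (ha : 0 ≤ a) (hb : 0 ≤ b)
    (h : ∀ u : Space d, ‖u‖ = 1 → ∃ f : UnitSphere d → ℝ, Integrable f (sphereProb d) ∧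
      (∀ θ, 0 ≤ f θ) ∧ (∀ θ : UnitSphere d, ⟪u, (θ : Space d)⟫ ≤ a + f θ) ∧ ∫ θ, f θ ∂sphereProb d ≤ b) :
    ‖steinerPoint S - steinerPoint S'‖
      ≤ d * (a * (meanSupport S - meanSupport S') + 2 * R * b) := by
  have hne' := hne.mono hSS
  have hR := radius_nonneg hS hne'
  have hS' := hSS.trans hS
  have hd : 0 ≤ (d : ℝ) := d.cast_nonneg
  have hc := continuous_supportFn_sphere hS hne'
  have hc' := continuous_supportFn_sphere hS' hne
  have hmean : meanSupport S' ≤ meanSupport S :=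
    integral_mono (integrable_sphereProb hc') (integrable_sphereProb hc)
      fun θ => supportFn_mono hS hne hSS θ
  refine norm_le_of_forall_inner_le (mul_nonneg hd (add_nonneg
    (mul_nonneg ha (sub_nonneg.2 hmean)) (by positivity))) fun u hu => ?_
  obtain ⟨f, hf, hf0, hfu, hfb⟩ := h u hu
  rw [inner_sub_right, inner_steinerPoint hS hne', inner_steinerPoint hS' hne, ← mul_sub,
    ← integral_sub (integrable_sphereProb (by fun_prop)) (integrable_sphereProb (by fun_prop))]
  gcongr
  calc ∫ θ : UnitSphere d, (⟪u, (θ : Space d)⟫ * supportFn S θ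
        - ⟪u, (θ : Space d)⟫ * supportFn S' θ) ∂sphereProb d
      ≤ ∫ θ : UnitSphere d, (a * (supportFn S θ - supportFn S' θ) + 2 * R * f θ)
          ∂sphereProb d := by
        refine integral_mono (integrable_sphereProb (by fun_prop))
          ((integrable_sphereProb (by fun_prop)).add (hf.const_mul _)) fun θ => ?_
        have h0 : 0 ≤ supportFn S (θ : Space d) - supportFn S' (θ : Space d) :=
          sub_nonneg.2 (supportFn_mono hS hne hSS θ)
        have h1 : supportFn S (θ : Space d) - supportFn S' (θ : Space d) ≤ 2 * R := by
          have h2 := abs_le.1 (abs_supportFn_sphere_le hS hne' θ)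
          have h3 := abs_le.1 (abs_supportFn_sphere_le hS' hne θ)
          linarith
        -- Pointwise, `⟪u, θ⟫ ≤ a + f θ` is multiplied by `h_S - h_S'`, which lies between `0` and
        -- `2R`; the upper bound is spent only on the `f` term.
        simp only
        nlinarith [mul_le_mul_of_nonneg_right (hfu θ) h0, mul_le_mul_of_nonneg_right h1 (hf0 θ)]
    _ = a * (meanSupport S - meanSupport S') + 2 * R * ∫ θ, f θ ∂sphereProb d := by
        rw [integral_add (integrable_sphereProb (by fun_prop)) (hf.const_mul _),
          integral_const_mul, integral_const_mul, integral_sub (integrable_sphereProb hc)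
          (integrable_sphereProb hc')]
        rfl
    _ ≤ _ := by gcongr

theorem norm_steinerPoint_sub_le_linear (hS : S ⊆ closedBall 0 R) (hne : S'.Nonempty)
    (hSS : S' ⊆ S) :
    ‖steinerPoint S - steinerPoint S'‖ ≤ d * (meanSupport S - meanSupport S') := by
  have := norm_steinerPoint_sub_le hS hne hSS zero_le_one le_rfl fun u hu =>
    ⟨0, integrable_zero _ _ _, fun _ => le_rfl, fun θ => ?_, by simp⟩
  · simpa using this
  · simpa [hu] using real_inner_le_norm u (θ : Space d)

/-- Outside the cap `⟪u, θ⟫ < ε`. Inside it, a cap of measure at most `p²` contributes at most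
`p/√d` to the integral of `⟪u, θ⟫`, by Cauchy–Schwarz with the second moment `1/d`. -/
theorem norm_steinerPoint_sub_le_of_cap (hS : S ⊆ closedBall 0 R) (hne : S'.Nonempty)
    (hSS : S' ⊆ S) {ε p : ℝ} (hε0 : 0 ≤ ε) (hε : ε ^ 2 ≤ 1 / 2) (hp : 0 < p)
    (hεp : √(1 - ε ^ 2) ^ d ≤ p ^ 2) :
    ‖steinerPoint S - steinerPoint S'‖
      ≤ d * ε * (meanSupport S - meanSupport S') + 2 * √d * p * R := by
  have hd : 0 < (d : ℝ) := by exact_mod_cast NeZero.pos d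
  have hs : 0 < √(d : ℝ) := Real.sqrt_pos.2 hd
  have hss : √(d : ℝ) * √d = d := Real.mul_self_sqrt hd.le
  have := norm_steinerPoint_sub_le hS hne hSS hε0 (b := p / √d) (by positivity) fun u hu => ?_
  · refine this.trans_eq ?_
    nth_rewrite 1 3 [← hss]
    field_simp
  · set A : Set (UnitSphere d) := {θ | ε ≤ ⟪u, (θ : Space d)⟫} with hA
    have hm : MeasurableSet A :=
      (isClosed_le continuous_const (continuous_inner_sphere u)).measurableSet
    -- The majorant `f` is the sum of this function and the next one: AM–GM for `⟪u, θ⟫ · 1`,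
    -- weighted so that each part has integral at most `p / (2√d)`.
    have hi1 : Integrable (fun θ : UnitSphere d => √d * p / 2 * ⟪u, (θ : Space d)⟫ ^ 2)
      (sphereProb d) := integrable_sphereProb (by fun_prop)
    have hi2 : Integrable (fun θ : UnitSphere d => 1 / (2 * √d * p) * A.indicator 1 θ)
      (sphereProb d) := ((integrable_const (1 : ℝ)).indicator hm).const_mul _
    refine ⟨_, hi1.add hi2, fun θ => ?_, fun θ => ?_, ?_⟩
    · have : 0 ≤ A.indicator (1 : UnitSphere d → ℝ) θ := indicator_nonneg (by simp) θ
      simp only [Pi.add_apply]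
      positivity
    · by_cases hθ : θ ∈ A
      · simp only [Pi.add_apply, indicator_of_mem hθ, Pi.one_apply]
        have h3 : √(d : ℝ) * p / 2 * ⟪u, (θ : Space d)⟫ ^ 2 + 1 / (2 * √d * p) * 1
            - ⟪u, (θ : Space d)⟫
            = 1 / (2 * √d * p) * (√d * p * ⟪u, (θ : Space d)⟫ - 1) ^ 2 := by
          field_simp
          ring
        have h4 : 0 ≤ 1 / (2 * √(d : ℝ) * p) * (√d * p * ⟪u, (θ : Space d)⟫ - 1) ^ 2 := by
          positivity
        linarith
      · simp only [Pi.add_apply, indicator_of_notMem hθ, mul_zero, add_zero]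
        have h1 : ⟪u, (θ : Space d)⟫ < ε := not_le.1 hθ
        have : 0 ≤ √(d : ℝ) * p / 2 * ⟪u, (θ : Space d)⟫ ^ 2 := by positivity
        linarith
    · simp only [Pi.add_apply]
      rw [integral_add hi1 hi2, integral_const_mul, integral_const_mul, integral_inner_sq, hu,
        integral_indicator_one hm]
      calc √(d : ℝ) * p / 2 * (1 ^ 2 / d) + 1 / (2 * √d * p) * (sphereProb d).real A
          ≤ √(d : ℝ) * p / 2 * (1 ^ 2 / (√d * √d)) + 1 / (2 * √d * p) * p ^ 2 := by
            rw [hss]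
            gcongr
            exact (sphereProb_cap_le hu hε0 hε).trans hεp
        _ = p / √d := by field_simp; norm_num

/-- If the reflection at the boundary of the half-space `{x | ⟪n, p⟫ ≤ ⟪n, x⟫}` moves the part of
`S` outside of the half-space into `S`, then the half-space contains the Steiner point of `S`. -/
theorem inner_le_inner_steinerPoint (hS : S ⊆ closedBall 0 R) (hne : S.Nonempty) {n p : Space d}
    (h : ∀ x ∈ S, ⟪n, x - p⟫ < 0 → p + (ℝ ∙ n)ᗮ.reflection (x - p) ∈ S) :
    ⟪n, p⟫ ≤ ⟪n, steinerPoint S⟫ := by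
  have hd : 0 < (d : ℝ) := by exact_mod_cast NeZero.pos d
  set ρ := (ℝ ∙ n)ᗮ.reflection
  have hc := continuous_supportFn_sphere hS hne
  -- `d ∫ F = ⟪n, st(S)⟫ - ⟪n, p⟫`, so the claim is `0 ≤ ∫ F`. Since `ρ` preserves the measure, it
  -- suffices that `F θ + F (ρ θ)` is nonnegative.
  let F : UnitSphere d → ℝ := fun θ =>
    ⟪n, (θ : Space d)⟫ * (supportFn S θ - ⟪(θ : Space d), p⟫)
  have hF : Continuous F := by fun_prop
  have hn : ∀ v, ⟪n, ρ v⟫ = -⟪n, v⟫ := fun v => by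
    rw [← inner_reflection_orthogonal_left,
      Submodule.reflection_orthogonalComplement_singleton_eq_neg, inner_neg_left]
  -- The support function of `S - p` is at least as large at `θ` as at its mirror image when `θ`
  -- points into the half-space: for `x` outside, the reflected point is a competitor at `θ`; for
  -- `x` inside, `x` itself is.
  have key : ∀ θ : UnitSphere d, 0 ≤ ⟪n, (θ : Space d)⟫ →
      supportFn S (ρ θ) - ⟪ρ θ, p⟫ ≤ supportFn S (θ : Space d) - ⟪(θ : Space d), p⟫ := by
    intro θ hθ
    suffices supportFn S (ρ θ) ≤ supportFn S (θ : Space d) - ⟪(θ : Space d), p⟫ + ⟪ρ θ, p⟫ by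
      linarith
    refine supportFn_le hne fun x hx => ?_
    suffices ⟪ρ θ, x - p⟫ ≤ supportFn S (θ : Space d) - ⟪(θ : Space d), p⟫ by
      rw [inner_sub_right] at this; linarith
    rcases lt_or_ge ⟪n, x - p⟫ 0 with hx' | hx'
    · have := inner_le_supportFn hS (h x hx hx') (θ : Space d)
      rw [inner_reflection_orthogonal_left]
      rw [inner_add_right] at this
      linarith
    · have h1 := inner_le_supportFn hS hx (θ : Space d)
      rw [reflection_orthogonal_singleton_apply, inner_sub_left, real_inner_smul_left]
      have : 0 ≤ 2 * (⟪n, (θ : Space d)⟫ / ‖n‖ ^ 2) * ⟪n, x - p⟫ := by positivity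
      rw [inner_sub_right (θ : Space d)]
      linarith
  have hpos : ∀ θ, 0 ≤ F θ + F (sphereMap ρ θ) := by
    intro θ
    simp only [F, coe_sphereMap, hn]
    rcases le_total 0 ⟪n, (θ : Space d)⟫ with hθ | hθ
    · nlinarith [mul_le_mul_of_nonneg_left (key θ hθ) hθ]
    · have := key (sphereMap ρ θ) (by rw [coe_sphereMap, hn]; linarith)
      rw [coe_sphereMap, Submodule.reflection_reflection] at this
      nlinarith [mul_le_mul_of_nonneg_left this (neg_nonneg.2 hθ)]
  have hF' : Continuous fun θ => F (sphereMap ρ θ) := hF.comp (continuous_sphereMap ρ)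
  have hint : 0 ≤ ∫ θ, F θ ∂sphereProb d := by
    have h1 : 0 ≤ ∫ θ, (F θ + F (sphereMap ρ θ)) ∂sphereProb d := integral_nonneg hpos
    rw [integral_add (integrable_sphereProb hF) (integrable_sphereProb hF'),
      integral_comp_sphereMap ρ hF] at h1
    linarith
  have hsplit : ∫ θ, F θ ∂sphereProb d
      = ∫ θ : UnitSphere d, ⟪n, (θ : Space d)⟫ * supportFn S θ ∂sphereProb d - ⟪n, p⟫ / d := by
    rw [← integral_inner_mul_inner, ← integral_sub (integrable_sphereProb (by fun_prop))
      (integrable_sphereProb (by fun_prop))]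
    simp only [F, mul_sub]
  rw [inner_steinerPoint hS hne]
  rw [hsplit, sub_nonneg, div_le_iff₀' hd] at hint
  exact hint

end Support

/-! ### Offline paths and sublevel sets of the work function. -/

variable {K : ℕ → Set (Space d)} {t : ℕ}

theorem pathCost_succ (x : ℕ → Space d) (t : ℕ) :
    pathCost x (t + 1) = pathCost x t + ‖x (t + 1) - x t‖ :=
  Finset.sum_range_succ _ _

theorem pathCost_nonneg (x : ℕ → Space d) (t : ℕ) : 0 ≤ pathCost x t :=
  Finset.sum_nonneg fun _ _ => norm_nonneg _

theorem norm_le_pathCost {x : ℕ → Space d} (hx : x 0 = 0) (t : ℕ) : ‖x t‖ ≤ pathCost x t := by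
  induction t with
  | zero => simp [hx, pathCost]
  | succ t ih =>
    rw [pathCost_succ]
    have := norm_add_le (x t) (x (t + 1) - x t)
    rw [add_sub_cancel] at this
    linarith

theorem IsFeasible.of_succ {x : ℕ → Space d} (h : IsFeasible K (t + 1) x) : IsFeasible K t x :=
  ⟨h.1, fun s h1 h2 => h.2 s h1 (by omega)⟩

theorem exists_isFeasible (hK : ∀ s, 1 ≤ s → s ≤ t → (K s).Nonempty) :
    ∃ x, IsFeasible K t x := by
  classical
  refine ⟨fun s => if h : 1 ≤ s ∧ s ≤ t then (hK s h.1 h.2).some else 0, by simp, fun s h1 h2 => ?_⟩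
  simp only [h1, h2, and_self, dite_true]
  exact (hK s h1 h2).some_mem

theorem opt_le {x : ℕ → Space d} (hx : IsFeasible K t x) : opt K t ≤ pathCost x t :=
  csInf_le ⟨0, by rintro _ ⟨y, -, rfl⟩; exact pathCost_nonneg y t⟩ ⟨x, hx, rfl⟩

theorem le_opt (hf : ∃ x, IsFeasible K t x) {a : ℝ}
    (h : ∀ x, IsFeasible K t x → a ≤ pathCost x t) : a ≤ opt K t :=
  let ⟨x, hx⟩ := hf
  le_csInf ⟨_, x, hx, rfl⟩ (by rintro _ ⟨y, hy, rfl⟩; exact h y hy)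

theorem opt_nonneg : 0 ≤ opt K t :=
  Real.sInf_nonneg (by rintro _ ⟨x, -, rfl⟩; exact pathCost_nonneg x t)

theorem opt_le_opt_succ (hf : ∃ x, IsFeasible K (t + 1) x) : opt K t ≤ opt K (t + 1) :=
  le_opt hf fun x hx => (opt_le hx.of_succ).trans (by
    rw [pathCost_succ]; linarith [norm_nonneg (x (t + 1) - x t)])

theorem work_le {x : ℕ → Space d} (hx : IsFeasible K t x) (y : Space d) :
    work K t y ≤ pathCost x t + ‖x t - y‖ := by
  refine csInf_le ⟨0, ?_⟩ ⟨x, hx, rfl⟩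
  rintro _ ⟨z, -, rfl⟩
  exact add_nonneg (pathCost_nonneg z t) (norm_nonneg _)

theorem le_work (hf : ∃ x, IsFeasible K t x) {y : Space d} {a : ℝ}
    (h : ∀ x, IsFeasible K t x → a ≤ pathCost x t + ‖x t - y‖) : a ≤ work K t y :=
  let ⟨x, hx⟩ := hf
  le_csInf ⟨_, x, hx, rfl⟩ (by rintro _ ⟨z, hz, rfl⟩; exact h z hz)

theorem sublevel_subset_closedBall (hf : ∃ x, IsFeasible K t x) (a : ℝ) :
    sublevel K t a ⊆ closedBall 0 a := by
  intro y hy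
  rw [mem_closedBall_zero_iff]
  refine (le_work hf fun x hx => ?_).trans hy
  have := norm_sub_le (x t) (x t - y)
  rw [sub_sub_cancel] at this
  linarith [norm_le_pathCost hx.1 t]

theorem sublevel_succ_subset (hf : ∃ x, IsFeasible K (t + 1) x) (a : ℝ) :
    sublevel K (t + 1) a ⊆ sublevel K t a := by
  intro y hy
  refine (le_work hf fun x hx => (work_le hx.of_succ y).trans ?_).trans hy
  rw [pathCost_succ]
  have := norm_sub_le_norm_sub_add_norm_sub (x t) (x (t + 1)) y
  rw [norm_sub_rev (x t) (x (t + 1))] at this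
  linarith

/-- The endpoint of a feasible path has work function at most the cost of that path. -/
theorem le_opt_of_sublevel_eq_empty (hf : ∃ x, IsFeasible K t x) {a : ℝ}
    (h : ¬(sublevel K t a).Nonempty) : a ≤ opt K t := by
  refine le_opt hf fun x hx => ?_
  by_contra! hlt
  exact h ⟨x t, (work_le hx _).trans (by simpa using hlt.le)⟩

/-- Reflecting a point into a half-space that contains the last request does not increase the
work function. -/
theorem reflection_mem_sublevel (ht : 1 ≤ t) (hf : ∃ x, IsFeasible K t x) {n p : Space d}
    (hn : ∀ y ∈ K t, ⟪n, p⟫ ≤ ⟪n, y⟫) {a : ℝ} {x : Space d} (hx : x ∈ sublevel K t a)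
    (hxp : ⟪n, x - p⟫ < 0) : p + (ℝ ∙ n)ᗮ.reflection (x - p) ∈ sublevel K t a := by
  refine (le_work hf fun z hz => (work_le hz _).trans ?_).trans hx
  gcongr
  -- The last stop `z t` is in `K t`, hence in the half-space, so it is at least as close to the
  -- mirror image as to `x`.
  have hz' : 0 ≤ ⟪n, z t - p⟫ := by
    rw [inner_sub_right]
    linarith [hn _ (hz.2 t ht le_rfl)]
  rw [← sub_sub, ← sub_sub_sub_cancel_right (z t) x p]
  refine le_of_sq_le_sq ?_ (norm_nonneg _)
  rw [norm_sub_sq_real (z t - p), norm_sub_sq_real (z t - p), LinearIsometryEquiv.norm_map,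
    reflection_orthogonal_singleton_apply, inner_sub_right, real_inner_smul_right,
    real_inner_comm n (z t - p)]
  have : 2 * (⟪n, x - p⟫ / ‖n‖ ^ 2) * ⟪n, z t - p⟫ ≤ 0 := by
    refine mul_nonpos_of_nonpos_of_nonneg ?_ hz'
    have := div_nonpos_of_nonpos_of_nonneg hxp.le (sq_nonneg ‖n‖)
    linarith
  linarith

/-- With `p` the projection of the Steiner point `z` onto `K t`, the half-space with normal `p - z`
through `p` contains `K t`. It then contains `z` too, which gives `‖p - z‖² ≤ 0`. -/
theorem steinerPoint_sublevel_mem [NeZero d] (ht : 1 ≤ t) (hf : ∃ x, IsFeasible K t x)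
    (hK : IsRequest (K t)) {a : ℝ} (hne : (sublevel K t a).Nonempty) :
    steinerPoint (sublevel K t a) ∈ K t := by
  set z := steinerPoint (sublevel K t a)
  obtain ⟨p, hp, hzp⟩ := exists_norm_eq_iInf_of_complete_convex hK.nonempty
    hK.closed.isComplete hK.convex z
  rw [norm_eq_iInf_iff_real_inner_le_zero hK.convex hp] at hzp
  have h : ⟪p - z, p⟫ ≤ ⟪p - z, z⟫ :=
    inner_le_inner_steinerPoint (sublevel_subset_closedBall hf a) hne fun x hx hxp =>
      reflection_mem_sublevel ht hf (fun y hy => by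
        have := hzp y hy
        rw [← neg_sub p z, inner_neg_left, inner_sub_right] at this
        linarith) hx hxp
  rw [← sub_nonpos, ← inner_sub_right, real_inner_self_nonpos, sub_eq_zero] at h
  exact h ▸ hp

/-! ### The doubling guess as a lower bound for the optimum. -/

theorem infDist_zero_le_opt (hf : ∃ x, IsFeasible K t x) (ht : 1 ≤ t) :
    infDist 0 (K t) ≤ opt K t :=
  le_opt hf fun x hx => by
    have := infDist_le_dist_of_mem (x := 0) (hx.2 t ht le_rfl)
    rw [dist_zero_left] at this
    exact this.trans (norm_le_pathCost hx.1 t)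

theorem zero_mem_sublevel_zero (h : ∀ s, 1 ≤ s → s ≤ t → (0 : Space d) ∈ K s) :
    (0 : Space d) ∈ sublevel K t 0 :=
  (work_le (x := 0) ⟨rfl, h⟩ 0).trans (by simp [pathCost])

theorem exists_doubling_nonempty (hf : ∃ x, IsFeasible K t x) {r : ℝ} (hr : 0 < r) :
    {n : ℕ | (sublevel K t (2 * (2 ^ n * r))).Nonempty}.Nonempty := by
  obtain ⟨x, hx⟩ := hf
  obtain ⟨n, hn⟩ := pow_unbounded_of_one_lt (pathCost x t / r) one_lt_two
  refine ⟨n, x t, (work_le hx _).trans ?_⟩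
  rw [sub_self, norm_zero, add_zero]
  rw [div_lt_iff₀ hr] at hn
  linarith [pathCost_nonneg x t]

theorem doubling_eq_or_le (K : ℕ → Set (Space d)) (t : ℕ) {r : ℝ} (hr : 0 ≤ r) :
    doubling K t r = r ∨ 2 * r ≤ doubling K t r := by
  rw [doubling]
  rcases Nat.eq_zero_or_pos (sInf {n : ℕ | (sublevel K t (2 * (2 ^ n * r))).Nonempty})
    with h | h
  · simp [h]
  · right
    gcongr
    exact le_self_pow₀ one_le_two h.ne'

theorem le_doubling (K : ℕ → Set (Space d)) (t : ℕ) {r : ℝ} (hr : 0 ≤ r) :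
    r ≤ doubling K t r :=
  le_mul_of_one_le_left hr (one_le_pow₀ one_le_two)

theorem doubling_le_opt (hf : ∃ x, IsFeasible K t x) {r : ℝ} (h : r ≤ opt K t) :
    doubling K t r ≤ opt K t := by
  rw [doubling]
  set n := sInf {n : ℕ | (sublevel K t (2 * (2 ^ n * r))).Nonempty} with hn
  rcases Nat.eq_zero_or_pos n with h0 | h0
  · simpa [h0]
  -- The last rejected guess `2 ^ (n - 1) * r` has an empty sublevel set at height twice itself,
  -- that is `2 ^ n * r`, which is therefore at most the optimum.
  · have h1 : n - 1 ∉ {n : ℕ | (sublevel K t (2 * (2 ^ n * r))).Nonempty} :=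
      Nat.notMem_of_lt_sInf (by omega)
    have h2 := le_opt_of_sublevel_eq_empty hf h1
    rwa [← mul_assoc, ← pow_succ', Nat.sub_add_cancel h0] at h2

section Guess

variable {T : ℕ}

theorem guess_nonneg (K : ℕ → Set (Space d)) (t : ℕ) : 0 ≤ guess K t := by
  induction t with
  | zero => exact le_rfl
  | succ t ih =>
    rw [guess]
    have h : 0 ≤ if guess K t = 0 then infDist 0 (K (t + 1)) else guess K t := by
      split_ifs
      exacts [infDist_nonneg, ih]
    exact h.trans (le_doubling K (t + 1) h)

theorem guess_succ_eq_or_le (K : ℕ → Set (Space d)) (t : ℕ) :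
    guess K (t + 1) = guess K t ∨ 2 * guess K t ≤ guess K (t + 1) := by
  by_cases h : guess K t = 0
  -- The initialization, out of guess `0`, counts as a doubling.
  · exact .inr (by simpa [h] using guess_nonneg K (t + 1))
  · rw [guess, if_neg h]
    exact doubling_eq_or_le K (t + 1) (guess_nonneg K t)

theorem guess_le_opt (hf : ∀ t ≤ T, ∃ x, IsFeasible K t x) (ht : t ≤ T) :
    guess K t ≤ opt K t := by
  induction t with
  | zero => exact opt_nonneg
  | succ t ih =>
    rw [guess]
    refine doubling_le_opt (hf _ ht) ?_
    split_ifs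
    · exact infDist_zero_le_opt (hf _ ht) (by omega)
    · exact (ih (by omega)).trans (opt_le_opt_succ (hf _ ht))

theorem zero_mem_of_guess_eq_zero (hK : ∀ t, 1 ≤ t → t ≤ T → IsRequest (K t)) (ht : t ≤ T)
    (h : guess K t = 0) : ∀ s, 1 ≤ s → s ≤ t → (0 : Space d) ∈ K s := by
  induction t with
  | zero => intro s h1 h2; omega
  | succ t ih =>
    rw [guess, doubling, mul_eq_zero, or_iff_right (by positivity)] at h
    split_ifs at h with h0
    · intro s h1 h2
      rcases h2.eq_or_lt with rfl | h2
      · have hr := hK _ h1 ht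
        exact (hr.closed.mem_iff_infDist_zero hr.nonempty).2 h
      · exact ih (by omega) h0 s h1 (by omega)
    · exact absurd h h0

theorem sublevel_guess_nonempty (hK : ∀ t, 1 ≤ t → t ≤ T → IsRequest (K t)) (ht : t ≤ T) :
    (sublevel K t (2 * guess K t)).Nonempty := by
  by_cases h : guess K t = 0
  · rw [h, mul_zero]
    exact ⟨0, zero_mem_sublevel_zero (zero_mem_of_guess_eq_zero hK ht h)⟩
  · cases t with
    | zero => exact absurd rfl h
    | succ t =>
      have hpos := (guess_nonneg K (t + 1)).lt_of_ne' h
      rw [guess, doubling, mul_pos_iff_of_pos_left (by positivity)] at hpos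
      rw [guess]
      exact Nat.sInf_mem (exists_doubling_nonempty
        (exists_isFeasible fun s h1 h2 => (hK s h1 (h2.trans ht)).nonempty) hpos)

/-- At time `0` the sublevel set lies in the ball of radius `0`, so its Steiner point is the
starting point; the amortization can thus treat all times alike. -/
theorem steinerTrajectory_eq [NeZero d] (K : ℕ → Set (Space d)) (t : ℕ) :
    steinerTrajectory K t = steinerPoint (sublevel K t (2 * guess K t)) := by
  cases t with
  | zero =>
    have hz : (0 : Space d) ∈ sublevel K 0 (2 * guess K 0) := by
      rw [guess, mul_zero]
      exact zero_mem_sublevel_zero fun s h1 h2 => by omega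
    have := norm_steinerPoint_le (sublevel_subset_closedBall
      (exists_isFeasible fun s h1 h2 => by omega) _) ⟨0, hz⟩
    rw [steinerTrajectory]
    simpa [guess, eq_comm] using this
  | succ t => rfl

end Guess

/-! ### Amortization and the two competitive ratios. -/

/-- Amortization over doubling phases, in terms of a potential `Φ` that is bounded by the guess. -/
theorem sum_le_of_doubling {r Φ δ : ℕ → ℝ} {A B s : ℝ} {T : ℕ} (hA : 0 ≤ A) (hB : 0 ≤ B)
    (hsA : s ≤ A) (hr : ∀ t, 0 ≤ r t) (hΦ : ∀ t ≤ T, |Φ t| ≤ 2 * r t)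
    (hstep : ∀ t < T, (r (t + 1) = r t ∧ δ t ≤ A * (Φ t - Φ (t + 1)) + B * r t) ∨
      (2 * r t ≤ r (t + 1) ∧ δ t ≤ s * (2 * r t) + s * (2 * r (t + 1)))) :
    ∑ t ∈ Finset.range T, δ t ≤ (14 * A + T * B) * r T := by
  -- The coefficient `12` is what a jump from `r` to `r' ≥ 2r` needs: movement and change of
  -- potential cost at most `4Ar + 4Ar'`, and `(12 + 4) r + 4 r' ≤ 12 r'`. The final `-A Φ T` turns
  -- `12` into `14`.
  suffices ∀ t ≤ T, ∑ i ∈ Finset.range t, δ i ≤ 12 * A * r t - A * Φ t + t * B * r t by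
    have h1 := this T le_rfl
    have h2 := mul_le_mul_of_nonneg_left (neg_le_of_abs_le (hΦ T le_rfl)) hA
    linarith
  intro t ht
  induction t with
  | zero =>
    have h2 := mul_le_mul_of_nonneg_left (le_of_abs_le (hΦ 0 ht)) hA
    have h3 := mul_nonneg hA (hr 0)
    simp only [Finset.range_zero, Finset.sum_empty, Nat.cast_zero]
    linarith
  | succ t ih =>
    rw [Finset.sum_range_succ]
    have ih := ih (by omega)
    push_cast
    rcases hstep t ht with ⟨h1, h2⟩ | ⟨h1, h2⟩
    · rw [h1]
      linarith
    · have h3 := mul_le_mul_of_nonneg_left (le_of_abs_le (hΦ _ ht)) hA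
      have h4 := mul_le_mul_of_nonneg_left (neg_le_of_abs_le (hΦ t (by omega))) hA
      have h5 := mul_le_mul_of_nonneg_left h1 hA
      have h6 := mul_le_mul_of_nonneg_right hsA (hr t)
      have h7 := mul_le_mul_of_nonneg_right hsA (hr (t + 1))
      have h8 : t * B * r t ≤ t * B * r (t + 1) := by
        gcongr
        linarith [hr t]
      have h9 := mul_nonneg hB (hr (t + 1))
      linarith

/-- Both ratios come from a one-step estimate with slope `A` and error `B R`. The radius is `R =
2r`, hence `2 * B`, and `√d ≤ A` lets `A` absorb the jumps. -/
theorem pathCost_steinerTrajectory_le [NeZero d] {T : ℕ}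
    (hK : ∀ t, 1 ≤ t → t ≤ T → IsRequest (K t)) {A B : ℝ} (hA : √d ≤ A) (hB : 0 ≤ B)
    (hstep : ∀ {S S' : Set (Space d)} {R : ℝ}, S ⊆ closedBall 0 R → S'.Nonempty → S' ⊆ S →
      ‖steinerPoint S - steinerPoint S'‖ ≤ A * (meanSupport S - meanSupport S') + B * R) :
    pathCost (steinerTrajectory K) T ≤ (14 * A + T * (2 * B)) * opt K T := by
  have hA0 : 0 ≤ A := (Real.sqrt_nonneg _).trans hA
  have hf : ∀ t ≤ T, ∃ x, IsFeasible K t x := fun t ht =>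
    exists_isFeasible fun s h1 h2 => (hK s h1 (h2.trans ht)).nonempty
  have hball : ∀ t ≤ T, sublevel K t (2 * guess K t) ⊆ closedBall 0 (2 * guess K t) :=
    fun t ht => sublevel_subset_closedBall (hf t ht) _
  have hne : ∀ t ≤ T, (sublevel K t (2 * guess K t)).Nonempty :=
    fun t ht => sublevel_guess_nonempty hK ht
  refine (sum_le_of_doubling (r := guess K) (s := √d) (B := 2 * B)
    (Φ := fun t => meanSupport (sublevel K t (2 * guess K t))) hA0 (by positivity) hA
    (guess_nonneg K) (fun t ht => abs_meanSupport_le (hball t ht) (hne t ht))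
    fun t ht => ?_).trans ?_
  · simp only [steinerTrajectory_eq]
    rcases guess_succ_eq_or_le K t with h | h
    · left
      refine ⟨h, ?_⟩
      have hne' := hne (t + 1) ht
      rw [h] at hne' ⊢
      rw [norm_sub_rev, mul_comm 2 B, mul_assoc]
      exact hstep (hball t ht.le) hne' (sublevel_succ_subset (hf (t + 1) ht) _)
    · right
      refine ⟨h, (norm_sub_le _ _).trans ?_⟩
      rw [add_comm]
      exact add_le_add (norm_steinerPoint_le (hball t ht.le) (hne t ht.le))
        (norm_steinerPoint_le (hball _ ht) (hne _ ht))
  · gcongr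
    exact guess_le_opt hf le_rfl

/-- With `ε² = 4 log T / d`, the bound `1 - ε² ≤ exp(-ε²)` gives `(1 - ε²)^(d/2) ≤ exp(-2 log T)`;
so `p = 1/T` is admissible in the cap estimate. -/
theorem sqrt_one_sub_pow_le {d : ℕ} (hd : 0 < d) {T : ℕ} (hT : 1 ≤ T) :
    √(1 - √(4 * Real.log T / d) ^ 2) ^ d ≤ (1 / (T : ℝ)) ^ 2 := by
  have hd' : (0 : ℝ) < d := by exact_mod_cast hd
  have hT' : (0 : ℝ) < T := by exact_mod_cast hT
  have hlog : 0 ≤ Real.log T := Real.log_natCast_nonneg T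
  rw [Real.sq_sqrt (by positivity)]
  have h1 : √(1 - 4 * Real.log T / d) ≤ Real.exp (-(2 * Real.log T / d)) := by
    rw [Real.sqrt_le_left (Real.exp_nonneg _), ← Real.exp_nat_mul]
    refine (Real.one_sub_le_exp_neg _).trans_eq ?_
    congr 1
    push_cast
    ring
  calc √(1 - 4 * Real.log T / d) ^ d ≤ Real.exp (-(2 * Real.log T / d)) ^ d := by gcongr
    _ = Real.exp (-Real.log T) ^ 2 := by
      rw [← Real.exp_nat_mul, ← Real.exp_nat_mul]
      congr 1
      push_cast
      field_simp
    _ = (1 / (T : ℝ)) ^ 2 := by rw [Real.exp_neg, Real.exp_log hT', one_div]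

theorem pathCost_steinerTrajectory_le_linear [NeZero d] {T : ℕ}
    (hK : ∀ t, 1 ≤ t → t ≤ T → IsRequest (K t)) :
    pathCost (steinerTrajectory K) T ≤ 14 * d * opt K T := by
  have h1 : (1 : ℝ) ≤ d := by exact_mod_cast NeZero.one_le
  have := pathCost_steinerTrajectory_le hK (A := d) (B := 0)
    (Real.sqrt_le_left (by positivity) |>.2 (by nlinarith)) le_rfl
    fun hS hne hSS => by simpa using norm_steinerPoint_sub_le_linear hS hne hSS
  simpa using this

theorem pathCost_steinerTrajectory_le_sqrt [NeZero d] {T : ℕ} (hT : 2 ≤ T)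
    (hK : ∀ t, 1 ≤ t → t ≤ T → IsRequest (K t)) :
    pathCost (steinerTrajectory K) T ≤ 42 * √(d * Real.log T) * opt K T := by
  have hd : 0 < d := NeZero.pos d
  have hd' : (0 : ℝ) < d := by exact_mod_cast hd
  have hT' : (0 : ℝ) < T := by exact_mod_cast (by omega : 0 < T)
  have hlog2 : 1 / 2 ≤ Real.log T := by
    have h1 := Real.log_two_gt_d9
    have h2 : Real.log 2 ≤ Real.log T := Real.log_le_log two_pos (by exact_mod_cast hT)
    linarith
  -- The first case is `ε² ≤ 1/2`; there the total is `28 √(d log T) + 4√d`, and `√d ≤ 2 √(d log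
  -- T)`. Otherwise `d² < 8 d log T`, so `d ≤ 3 √(d log T)` and the linear bound gives `14 · 3 =
  -- 42`.
  rcases le_or_gt (8 * Real.log T) d with h | h
  · have hε : √(4 * Real.log T / d) ^ 2 ≤ 1 / 2 := by
      rw [Real.sq_sqrt (by positivity), div_le_iff₀ hd']
      linarith
    have hA : (d : ℝ) * √(4 * Real.log T / d) = 2 * √(d * Real.log T) := by
      rw [← sq_eq_sq₀ (by positivity) (by positivity), mul_pow, mul_pow,
        Real.sq_sqrt (by positivity), Real.sq_sqrt (by positivity)]
      field_simp
      ring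
    have hsA : √(d : ℝ) ≤ 2 * √(d * Real.log T) := by
      rw [Real.sqrt_le_left (by positivity), mul_pow, Real.sq_sqrt (by positivity)]
      nlinarith
    have := pathCost_steinerTrajectory_le hK (A := 2 * √(d * Real.log T))
      (B := 2 * √d * (1 / T)) hsA (by positivity) fun hS hne hSS => by
        rw [← hA]
        exact norm_steinerPoint_sub_le_of_cap hS hne hSS (Real.sqrt_nonneg _) hε
          (by positivity) (sqrt_one_sub_pow_le hd (by omega))
    refine this.trans ?_
    have hT0 : (T : ℝ) * (2 * (2 * √d * (1 / T))) = 4 * √d := by field_simp; norm_num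
    rw [hT0]
    have := opt_nonneg (K := K) (t := T)
    gcongr
    linarith [Real.sqrt_nonneg (d * Real.log T)]
  · refine (pathCost_steinerTrajectory_le_linear hK).trans ?_
    have := opt_nonneg (K := K) (t := T)
    refine mul_le_mul_of_nonneg_right ?_ this
    have : (d : ℝ) ≤ 3 * √(d * Real.log T) := by
      refine le_of_sq_le_sq ?_ (by positivity)
      rw [mul_pow, Real.sq_sqrt (by positivity)]
      nlinarith
    linarith

end

end BodyChasing

theorem theorem1 :
    ∃ C : ℝ, 0 < C ∧ ∀ d T : ℕ, 2 ≤ T →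
      (BodyChasing.steinerAlgorithm d).IsCompetitive T
        (C * min (d : ℝ) (Real.sqrt ((d : ℝ) * Real.log (T : ℝ)))) := by
  refine ⟨42, by norm_num, fun d T hT K hK => ?_⟩
  change (∀ t, 1 ≤ t → t ≤ T → BodyChasing.steinerTrajectory K t ∈ K t) ∧
    BodyChasing.pathCost (BodyChasing.steinerTrajectory K) T ≤ _
  rcases Nat.eq_zero_or_pos d with rfl | hd
  · refine ⟨fun t h1 h2 => ?_, ?_⟩
    · obtain ⟨y, hy⟩ := (hK t h1 h2).nonempty
      rwa [Subsingleton.elim (BodyChasing.steinerTrajectory K t) y]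
    · simp [BodyChasing.pathCost, Subsingleton.elim _ (0 : BodyChasing.Space 0)]
  · have : NeZero d := ⟨hd.ne'⟩
    refine ⟨fun t h1 h2 => ?_, ?_⟩
    · rw [BodyChasing.steinerTrajectory_eq]
      exact BodyChasing.steinerPoint_sublevel_mem h1
        (BodyChasing.exists_isFeasible fun s h3 h4 => (hK s h3 (h4.trans h2)).nonempty)
        (hK t h1 h2) (BodyChasing.sublevel_guess_nonempty hK h2)
    · have h0 := BodyChasing.opt_nonneg (K := K) (t := T)
      rcases min_choice (d : ℝ) (Real.sqrt ((d : ℝ) * Real.log (T : ℝ))) with h | h <;> rw [h]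
      · refine (BodyChasing.pathCost_steinerTrajectory_le_linear hK).trans ?_
        gcongr
        norm_num
      · exact BodyChasing.pathCost_steinerTrajectory_le_sqrt hT hK
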